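/- **Theorem.** Let $d\ge 0$, let $\mathcal Z\subset\{0,1\}^d$, and identify each $z\in\mathcal Z$ with the set $\{i\in[d]: z_i=1\}$. Assume that for every $i\in[d]$ there are $z,z'\in\mathcal Z$ with $i\in z$ and $i\notin z'$. In the combinatorial bandit with parameter $\theta\in\mathbb R^d$, an algorithm $\mathcal A$ selects in each round $t$ an index $I_t\in[d]$ (pulls $e_{I_t}$) as a measurable function of the past pulls and observations (and possibly of an independent internal random seed), and observes $Y_t=\theta_{I_t}+\eta_t$, where the $\eta_t$ are i.i.d. $N(0,\sigma^2)$ with $\sigma^2>0$. It stops at a (possibly infinite) stopping time $\tau$ of the observed history and the seed, and then recommends some $\widehat z\in\mathcal Z$. For $\Theta\subset\mathbb R^d$ let $\Theta_{1}$ be the set of $\theta'\in\Theta$ for which $\operatorname{argmax}_{z\in\mathcal Z}\langle z,\theta'\rangle$ is a single item $z_*(\theta')$. The algorithm is $\delta$-PAC for $\Theta$ if $\mathbb P_{\theta'}(\tau<\infty,\ \widehat z=z_*(\theta'))\ge 1-\delta$ for all $\theta'\in\Theta_{1}$. Let $\delta\in(0,1/4)$, let $\theta\in\Theta_{1}$,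 and write $z_*=z_*(\theta)$ and $\Delta_z=\langle z_*-z,\theta\rangle$. Suppose that for every $i\in[d]$: * if $i\in z_*$, then $\theta-s\,e_i\in\overline{\Theta_{1}}$ for some $s>\min_{z\in\mathcal Z:\, i\in z_*\setminus z}\Delta_z$; * if $i\notin z_*$, then $\theta+s\,e_i\in\overline{\Theta_{1}}$ for some $s>\min_{z\in\mathcal Z:\, i\in z\setminus z_*}\Delta_z$. (Here $\overline{\Theta_1}$ is the closure of $\Theta_1$ in $\mathbb R^d$. The condition holds, for instance, if these perturbed vectors belong to $\Theta$ and have a unique best item, and it always holds for $\Theta=\mathbb R^d$.) If $\mathcal A$ is $\delta$-PAC for $\Theta$ and $T_i$ denotes the number of times that $\mathcal A$ pulls $e_i$ before it stops, then $$\mathbb E_\theta\Big[\sum_{i=1}^d T_i\Big]\ \ge\ \frac d2 ,$$ where the expectation may be $+\infty$. -/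

import Mathlib

open MeasureTheory ProbabilityTheory
open scoped ENNReal NNReal

noncomputable section

namespace CombBandit

/-! Combinatorial bandits: the measurement vectors are `e_1, …, e_d`, so a measurement is an index
in `Fin d`, and a vector `z ∈ {0,1}^d` is identified with the set of its nonzero coordinates. -/

/-- The value `⟨z, θ⟩` of an item. -/
def value {d : ℕ} (θ : Fin d → ℝ) (z : Finset (Fin d)) : ℝ := ∑ i ∈ z, θ i

/-- `argmax_{z ∈ Z} ⟨z, θ⟩ = {z}`. -/
def IsUniqueBest {d : ℕ} (Z : Finset (Finset (Fin d))) (θ : Fin d → ℝ)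
    (z : Finset (Fin d)) : Prop :=
  z ∈ Z ∧ ∀ z' ∈ Z, z' ≠ z → value θ z' < value θ z

/-- The gap `Δ_z = ⟨z_* - z, θ⟩`. -/
def gap {d : ℕ} (θ : Fin d → ℝ) (zs z : Finset (Fin d)) : ℝ := value θ zs - value θ z

/-- `min_{z ∈ Z, i ∈ z_* \ z} Δ_z`, for `i ∈ z_*`. -/
def minGapWithout {d : ℕ} (Z : Finset (Finset (Fin d))) (θ : Fin d → ℝ) (zs : Finset (Fin d))
    (i : Fin d) : ℝ :=
  sInf (gap θ zs '' {z | z ∈ Z ∧ i ∈ zs \ z})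

/-- `min_{z ∈ Z, i ∈ z \ z_*} Δ_z`, for `i ∉ z_*`. -/
def minGapWith {d : ℕ} (Z : Finset (Finset (Fin d))) (θ : Fin d → ℝ) (zs : Finset (Fin d))
    (i : Fin d) : ℝ :=
  sInf (gap θ zs '' {z | z ∈ Z ∧ i ∈ z \ zs})

/-- The parameters in `Θ` for which the best item is unique. -/
def uniqueInstances {d : ℕ} (Z : Finset (Finset (Fin d))) (Θ : Set (Fin d → ℝ)) :
    Set (Fin d → ℝ) :=
  {θ | θ ∈ Θ ∧ ∃ z, IsUniqueBest Z θ z}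

/-- The history of the first `t` rounds: the pairs (measurement, observation). -/
abbrev History (d t : ℕ) : Type := Fin t → Fin d × ℝ

/-- A sequential algorithm: a sampling rule, a stopping rule and a recommendation rule, each a
measurable function of the past observations and of an internal random seed in `U` (for an
algorithm without internal randomization, `U` is a one-point space). -/
structure Algorithm (d : ℕ) (Z : Finset (Finset (Fin d))) (U : Type*) [MeasurableSpace U] where
  /-- the measurement chosen after `t` rounds -/
  sample : (t : ℕ) → U × History d t → Fin d
  measurable_sample : ∀ t, Measurable (sample t)
  /-- the seeds and histories on which the algorithm stops after `t` rounds -/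
  halt : (t : ℕ) → Set (U × History d t)
  measurableSet_halt : ∀ t, MeasurableSet (halt t)
  /-- the item recommended if the algorithm stops after `t` rounds -/
  recommend : (t : ℕ) → U × History d t → Finset (Fin d)
  measurableSet_recommend : ∀ t z, MeasurableSet {p | recommend t p = z}
  recommend_mem : ∀ t p, recommend t p ∈ Z

/-- The law of the seed and of the independent `N(0, v)` noise variables. -/
def seedNoise {U : Type*} [MeasurableSpace U] (ρ : Measure U) (v : ℝ≥0) :
    Measure (U × (ℕ → ℝ)) :=
  ρ.prod (Measure.infinitePi fun _ : ℕ => gaussianReal 0 v)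

namespace Algorithm

variable {d : ℕ} {Z : Finset (Finset (Fin d))} {U : Type*} [MeasurableSpace U]

/-- The history of the first `t` rounds on the instance `θ`: pulling `e_x` in the round with
noise `η` gives the observation `θ_x + η`. -/
def history (A : Algorithm d Z U) (θ : Fin d → ℝ) (ω : U × (ℕ → ℝ)) : (t : ℕ) → History d t
  | 0 => Fin.elim0
  | t + 1 =>
    let h := history A θ ω t
    Fin.snoc (α := fun _ => Fin d × ℝ) h
      (A.sample t (ω.1, h), θ (A.sample t (ω.1, h)) + ω.2 t)

/-- The measurement that the sampling rule selects after `t` rounds. -/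
def arm (A : Algorithm d Z U) (θ : Fin d → ℝ) (ω : U × (ℕ → ℝ)) (t : ℕ) : Fin d :=
  A.sample t (ω.1, A.history θ ω t)

/-- The stopping time `τ`, with value `⊤` if the algorithm never stops. -/
def stoppingTime (A : Algorithm d Z U) (θ : Fin d → ℝ) (ω : U × (ℕ → ℝ)) : ℕ∞ :=
  ⨅ (t : ℕ) (_ : (ω.1, A.history θ ω t) ∈ A.halt t), (t : ℕ∞)

/-- The event that the algorithm stops and recommends `z`. -/
def recommends (A : Algorithm d Z U) (θ : Fin d → ℝ) (z : Finset (Fin d)) :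
    Set (U × (ℕ → ℝ)) :=
  {ω | ∃ t : ℕ, A.stoppingTime θ ω = t ∧ A.recommend t (ω.1, A.history θ ω t) = z}

/-- `T_i`, the number of pulls of `e_i` before the algorithm stops. -/
def pulls (A : Algorithm d Z U) (θ : Fin d → ℝ) (i : Fin d) (ω : U × (ℕ → ℝ)) : ℕ∞ :=
  Set.encard {t : ℕ | (t : ℕ∞) < A.stoppingTime θ ω ∧ A.arm θ ω t = i}

/-- The algorithm is `δ`-PAC for `Θ`: on every instance of `Θ` with a unique best item, it stops
and recommends this item with probability at least `1 - δ`. -/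
def IsPAC (A : Algorithm d Z U) (ρ : Measure U) (v : ℝ≥0) (Θ : Set (Fin d → ℝ)) (δ : ℝ) : Prop :=
  ∀ θ ∈ Θ, ∀ z, IsUniqueBest Z θ z →
    ENNReal.ofReal (1 - δ) ≤ seedNoise ρ v (A.recommends θ z)

end Algorithm

end CombBandit

end

open Filter Topology

/-! Each arm must be pulled at least once with probability at least `1 - 2δ ≥ 1/2`; summing over
arms gives `d/2`. To see this for arm `i`, change only `θ i` so that `zs` loses to another item.
Driven by the same seed and noise, the two instances produce identical runs as long as `e_i` is not
pulled, so recommending `zs` at `θ` forces either a pull of `e_i` or recommending `zs` at the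
perturbed parameter (`le_measure_pulls_ne_zero`). The perturbed parameter is only a limit of
instances where the PAC guarantee applies. The probability of recommending `zs` is lower
semicontinuous in the parameter (`lowerSemicontinuous_measure_recommends`), so the bound `δ` passes
to the limit (`measure_recommends_le`). -/

namespace CombBandit

/-! ### Continuity of the Gaussian law in its mean -/

/-- Total variation continuity of the Gaussian in its mean, in one-sided form. -/
theorem eventually_lintegral_gaussianReal_le (v : ℝ≥0) (hv : v ≠ 0) (b : ℝ) {ε : ℝ≥0∞}
    (hε : ε ≠ 0) :
    ∀ᶠ a in 𝓝 b, ∀ f : ℝ → ℝ≥0∞, Measurable f → (∀ x, f x ≤ 1) →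
      ∫⁻ x, f x ∂(gaussianReal b v) ≤ ∫⁻ x, f x ∂(gaussianReal a v) + ε := by
  -- Subtraction in `ℝ≥0∞` is truncated, so this is the integral of the positive part, dominated by
  -- the fixed density at `b`.
  have hlim : Tendsto (fun a => ∫⁻ x, (gaussianPDF b v x - gaussianPDF a v x)) (𝓝 b) (𝓝 0) := by
    have h0 : ∫⁻ _ : ℝ, (0 : ℝ≥0∞) = 0 := by simp
    rw [← h0]
    refine tendsto_lintegral_filter_of_dominated_convergence (gaussianPDF b v)
      (.of_forall fun a => by fun_prop) (.of_forall fun a => .of_forall fun x => tsub_le_self)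
      (by rw [lintegral_gaussianPDF_eq_one b hv]; simp) (.of_forall fun x => ?_)
    have hcont : Continuous fun a => gaussianPDF a v x := by
      unfold gaussianPDF gaussianPDFReal
      exact ENNReal.continuous_ofReal.comp (by fun_prop)
    have := ENNReal.Tendsto.sub (tendsto_const_nhds (x := gaussianPDF b v x)) (hcont.tendsto b)
      (Or.inl gaussianPDF_lt_top.ne)
    simpa using this
  filter_upwards [(ENNReal.tendsto_nhds_zero.1 hlim) ε (pos_iff_ne_zero.2 hε)] with a ha f hf hf1
  rw [gaussianReal_of_var_ne_zero _ hv, gaussianReal_of_var_ne_zero _ hv,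
    lintegral_withDensity_eq_lintegral_mul _ (measurable_gaussianPDF _ _) hf,
    lintegral_withDensity_eq_lintegral_mul _ (measurable_gaussianPDF _ _) hf]
  refine le_trans ?_ (add_le_add_right ha _)
  rw [← lintegral_add_left (by fun_prop)]
  refine lintegral_mono fun x => ?_
  simp only [Pi.mul_apply]
  calc gaussianPDF b v x * f x
      ≤ (gaussianPDF a v x + (gaussianPDF b v x - gaussianPDF a v x)) * f x := by
        gcongr; exact le_add_tsub
    _ ≤ gaussianPDF a v x * f x + (gaussianPDF b v x - gaussianPDF a v x) := by
        rw [add_mul]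
        gcongr
        exact mul_le_of_le_one_right zero_le (hf1 x)

instance {U : Type*} [MeasurableSpace U] (ρ : Measure U) [IsProbabilityMeasure ρ] (v : ℝ≥0) :
    IsProbabilityMeasure (seedNoise ρ v) := by
  unfold seedNoise; infer_instance

/-! ### Perturbing one coordinate -/

theorem continuous_value {d : ℕ} (z : Finset (Fin d)) : Continuous fun θ => value θ z := by
  unfold value; fun_prop

theorem value_add_single {d : ℕ} (θ : Fin d → ℝ) (i : Fin d) (s : ℝ) (z : Finset (Fin d)) :
    value (θ + Pi.single i s) z = value θ z + if i ∈ z then s else 0 := by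
  simp [value, Finset.sum_add_distrib]

/-- The perturbation costs `zs` the amount `s` and leaves every `z` avoiding `i` untouched. `hZ`
makes the infimum range over a nonempty set, so it is not the default `0`. -/
theorem exists_value_lt_sub_single {d : ℕ} {Z : Finset (Finset (Fin d))} {θ : Fin d → ℝ}
    {zs : Finset (Fin d)} {i : Fin d} {s : ℝ} (hZ : ∃ z ∈ Z, i ∉ z) (hi : i ∈ zs)
    (hs : minGapWithout Z θ zs i < s) :
    ∃ z ∈ Z, value (θ - Pi.single i s) zs < value (θ - Pi.single i s) z := by
  obtain ⟨z₀, hz₀, hiz₀⟩ := hZ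
  have hne : {z | z ∈ Z ∧ i ∈ zs \ z}.Nonempty := ⟨z₀, hz₀, by simp [hi, hiz₀]⟩
  obtain ⟨_, ⟨z, ⟨hz, hiz⟩, rfl⟩, hlt⟩ := exists_lt_of_csInf_lt (hne.image (gap θ zs)) hs
  refine ⟨z, hz, ?_⟩
  rw [Finset.mem_sdiff] at hiz
  have e : θ - Pi.single i s = θ + Pi.single i (-s) := by rw [Pi.single_neg, sub_eq_add_neg]
  rw [e, value_add_single, value_add_single, if_pos hi, if_neg hiz.2]
  unfold gap at hlt
  linarith

theorem exists_value_lt_add_single {d : ℕ} {Z : Finset (Finset (Fin d))} {θ : Fin d → ℝ}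
    {zs : Finset (Fin d)} {i : Fin d} {s : ℝ} (hZ : ∃ z ∈ Z, i ∈ z) (hi : i ∉ zs)
    (hs : minGapWith Z θ zs i < s) :
    ∃ z ∈ Z, value (θ + Pi.single i s) zs < value (θ + Pi.single i s) z := by
  obtain ⟨z₀, hz₀, hiz₀⟩ := hZ
  have hne : {z | z ∈ Z ∧ i ∈ z \ zs}.Nonempty := ⟨z₀, hz₀, by simp [hi, hiz₀]⟩
  obtain ⟨_, ⟨z, ⟨hz, hiz⟩, rfl⟩, hlt⟩ := exists_lt_of_csInf_lt (hne.image (gap θ zs)) hs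
  refine ⟨z, hz, ?_⟩
  rw [Finset.mem_sdiff] at hiz
  rw [value_add_single, value_add_single, if_neg hi, if_pos hiz.1]
  unfold gap at hlt
  linarith

/-! ### Laws of finite histories -/

namespace Algorithm

variable {d : ℕ} {Z : Finset (Finset (Fin d))} {U : Type*} [MeasurableSpace U]

/-- One round: the seed and the extended history, given the seed, the history and the noise. -/
def extend (A : Algorithm d Z U) (θ : Fin d → ℝ) (t : ℕ) (q : (U × History d t) × ℝ) :
    U × History d (t + 1) :=
  (q.1.1, Fin.snoc (α := fun _ => Fin d × ℝ) q.1.2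
    (A.sample t q.1, θ (A.sample t q.1) + q.2))

theorem history_succ (A : Algorithm d Z U) (θ : Fin d → ℝ) (ω : U × (ℕ → ℝ)) (t : ℕ) :
    (ω.1, A.history θ ω (t + 1)) = A.extend θ t ((ω.1, A.history θ ω t), ω.2 t) := rfl

theorem measurable_extend (A : Algorithm d Z U) (θ : Fin d → ℝ) (t : ℕ) :
    Measurable (A.extend θ t) := by
  have hs : Measurable fun q : (U × History d t) × ℝ => A.sample t q.1 :=
    (A.measurable_sample t).comp measurable_fst
  refine measurable_fst.fst.prodMk (measurable_pi_iff.2 fun j => ?_)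
  refine Fin.lastCases ?_ (fun j => ?_) j
  · simp only [Fin.snoc_last]
    exact hs.prodMk (((measurable_of_finite θ).comp hs).add measurable_snd)
  · simp only [Fin.snoc_castSucc]
    exact (measurable_pi_apply j).comp measurable_fst.snd

theorem measurable_history (A : Algorithm d Z U) (θ : Fin d → ℝ) (t : ℕ) :
    Measurable fun ω : U × (ℕ → ℝ) => (ω.1, A.history θ ω t) := by
  induction t with
  | zero => exact measurable_fst.prodMk (measurable_pi_iff.2 fun j => j.elim0)
  | succ t ih =>
    simp only [history_succ]
    exact (A.measurable_extend θ t).comp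
      (ih.prodMk ((measurable_pi_apply t).comp measurable_snd))

theorem history_congr_noise (A : Algorithm d Z U) (θ : Fin d → ℝ) (u : U) {x y : ℕ → ℝ} {t : ℕ}
    (h : ∀ s < t, x s = y s) : A.history θ (u, x) t = A.history θ (u, y) t := by
  induction t with
  | zero => rfl
  | succ t ih =>
    simp only [history, ih fun s hs => h s (hs.trans t.lt_succ_self), h t t.lt_succ_self]

theorem indepFun_history_noise (A : Algorithm d Z U) (θ : Fin d → ℝ) (u : U) (v : ℝ≥0) (t : ℕ) :
    IndepFun (fun x : ℕ → ℝ => A.history θ (u, x) t) (fun x => x t)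
      (Measure.infinitePi fun _ : ℕ => gaussianReal 0 v) := by
  have hI : iIndepFun (fun (s : ℕ) (x : ℕ → ℝ) => x s)
      (Measure.infinitePi fun _ : ℕ => gaussianReal 0 v) :=
    iIndepFun_infinitePi (X := fun _ x => x) fun _ => measurable_id
  have h := hI.indepFun_finset (Finset.range t) {t} (by simp) fun s => measurable_pi_apply s
  -- Padding by zeros exhibits the history as a measurable function of the first `t` noise variables
  -- alone.
  let pad : (↥(Finset.range t) → ℝ) → ℕ → ℝ :=
    fun y s => if hs : s ∈ Finset.range t then y ⟨s, hs⟩ else 0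
  have hpad : Measurable pad := measurable_pi_iff.2 fun s => by
    by_cases hs : s ∈ Finset.range t
    · simpa only [pad, hs, dite_true] using measurable_pi_apply _
    · simp only [pad, hs, dite_false, measurable_const]
  have hφ : Measurable fun y => A.history θ (u, pad y) t :=
    ((A.measurable_history θ t).comp (measurable_const.prodMk hpad)).snd
  have hψ : Measurable fun y : ({t} : Finset ℕ) → ℝ => y ⟨t, by simp⟩ := measurable_pi_apply _
  have e : (fun x : ℕ → ℝ => A.history θ (u, x) t) =
      (fun y => A.history θ (u, pad y) t) ∘ fun (x : ℕ → ℝ) (s : Finset.range t) => x s := by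
    funext x
    exact A.history_congr_noise θ u fun s hs => by simp [pad, hs]
  rw [e]
  exact h.comp hφ hψ

theorem lintegral_history_succ (A : Algorithm d Z U) (ρ : Measure U) [IsProbabilityMeasure ρ]
    (v : ℝ≥0) (θ : Fin d → ℝ) (t : ℕ) {f : U × History d (t + 1) → ℝ≥0∞} (hf : Measurable f) :
    ∫⁻ ω, f (ω.1, A.history θ ω (t + 1)) ∂(seedNoise ρ v) =
      ∫⁻ ω, ∫⁻ y, f (A.extend θ t ((ω.1, A.history θ ω t), y)) ∂(gaussianReal 0 v)
        ∂(seedNoise ρ v) := by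
  have hg : Measurable fun q => f (A.extend θ t q) := hf.comp (A.measurable_extend θ t)
  have hG : Measurable fun p => ∫⁻ y, f (A.extend θ t (p, y)) ∂(gaussianReal 0 v) :=
    hg.lintegral_prod_right'
  unfold seedNoise
  rw [lintegral_prod (fun ω : U × (ℕ → ℝ) => f (ω.1, A.history θ ω (t + 1)))
      (hf.comp (A.measurable_history θ (t + 1))).aemeasurable,
    lintegral_prod (fun ω : U × (ℕ → ℝ) => ∫⁻ y, f (A.extend θ t ((ω.1, A.history θ ω t), y))
      ∂(gaussianReal 0 v)) (hG.comp (A.measurable_history θ t)).aemeasurable]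
  refine lintegral_congr fun u => ?_
  have hm : Measurable fun x : ℕ → ℝ => A.history θ (u, x) t :=
    ((A.measurable_history θ t).comp measurable_prodMk_left).snd
  have hgu : Measurable fun q : History d t × ℝ => f (A.extend θ t ((u, q.1), q.2)) :=
    hg.comp ((measurable_const.prodMk measurable_fst).prodMk measurable_snd)
  have hprod := (indepFun_iff_map_prod_eq_prod_map_map hm.aemeasurable
    (measurable_pi_apply t).aemeasurable).1 (A.indepFun_history_noise θ u v t)
  rw [Measure.infinitePi_map_eval (fun _ : ℕ => gaussianReal 0 v) t] at hprod
  calc ∫⁻ x, f (u, A.history θ (u, x) (t + 1)) ∂(Measure.infinitePi fun _ => gaussianReal 0 v)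
      = ∫⁻ q, f (A.extend θ t ((u, q.1), q.2)) ∂((Measure.infinitePi fun _ =>
          gaussianReal 0 v).map fun x => (A.history θ (u, x) t, x t)) := by
        rw [lintegral_map hgu (hm.prodMk (measurable_pi_apply t))]
        rfl
    _ = _ := by
        rw [hprod, lintegral_prod _ hgu.aemeasurable, lintegral_map hgu.lintegral_prod_right' hm]

/-- The law of a finite history is continuous in the parameter, in (one-sided) total variation. -/
theorem eventually_lintegral_history_le (A : Algorithm d Z U) (ρ : Measure U)
    [IsProbabilityMeasure ρ] (v : ℝ≥0) (hv : v ≠ 0) (θ : Fin d → ℝ) (t : ℕ) {ε : ℝ≥0∞}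
    (hε : ε ≠ 0) :
    ∀ᶠ θ' in 𝓝 θ, ∀ f : U × History d t → ℝ≥0∞, Measurable f → (∀ p, f p ≤ 1) →
      ∫⁻ ω, f (ω.1, A.history θ ω t) ∂(seedNoise ρ v) ≤
        ∫⁻ ω, f (ω.1, A.history θ' ω t) ∂(seedNoise ρ v) + ε := by
  induction t generalizing ε with
  | zero => exact .of_forall fun θ' f _ _ => le_self_add
  | succ t ih =>
    -- One half pays for the first `t` rounds, the other for the new observation.
    have hε2 : ε / 2 ≠ 0 := (ENNReal.half_pos hε).ne'
    have hg : ∀ᶠ θ' in 𝓝 θ, ∀ a : Fin d, ∀ f : ℝ → ℝ≥0∞, Measurable f → (∀ x, f x ≤ 1) →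
        ∫⁻ x, f x ∂(gaussianReal (θ a) v) ≤ ∫⁻ x, f x ∂(gaussianReal (θ' a) v) + ε / 2 :=
      eventually_all.2 fun a => ((continuous_apply a).tendsto θ).eventually
        (eventually_lintegral_gaussianReal_le v hv (θ a) hε2)
    have hshift : ∀ (θ' : Fin d → ℝ) (a : Fin d) {f : ℝ → ℝ≥0∞}, Measurable f →
        ∫⁻ x, f x ∂(gaussianReal (θ' a) v) = ∫⁻ y, f (θ' a + y) ∂(gaussianReal 0 v) := by
      intro θ' a f hf
      rw [← lintegral_map hf (measurable_const_add _), gaussianReal_map_const_add, zero_add]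
    filter_upwards [ih hε2, hg] with θ' ih hg f hf hf1
    rw [A.lintegral_history_succ ρ v θ t hf, A.lintegral_history_succ ρ v θ' t hf]
    have hG : Measurable fun p => ∫⁻ y, f (A.extend θ' t (p, y)) ∂(gaussianReal 0 v) :=
      (hf.comp (A.measurable_extend θ' t)).lintegral_prod_right'
    have hstep : ∀ p, ∫⁻ y, f (A.extend θ t (p, y)) ∂(gaussianReal 0 v) ≤
        ∫⁻ y, f (A.extend θ' t (p, y)) ∂(gaussianReal 0 v) + ε / 2 := by
      intro p
      -- At parameter `0` the noise slot is the observation itself, so the parameter enters only as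
      -- the mean of the Gaussian fed to `F`.
      let F : ℝ → ℝ≥0∞ := fun x => f (A.extend 0 t (p, x))
      have hF : Measurable F :=
        (hf.comp (A.measurable_extend 0 t)).comp measurable_prodMk_left
      have key : ∀ θ'' : Fin d → ℝ, ∀ y, f (A.extend θ'' t (p, y)) =
          F (θ'' (A.sample t p) + y) := fun θ'' y => by simp [F, extend]
      simp only [key]
      rw [← hshift θ _ hF, ← hshift θ' _ hF]
      exact hg _ F hF fun x => hf1 _
    calc _ ≤ ∫⁻ ω, ((∫⁻ y, f (A.extend θ' t ((ω.1, A.history θ ω t), y)) ∂(gaussianReal 0 v))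
            + ε / 2) ∂(seedNoise ρ v) := lintegral_mono fun ω => hstep _
      _ = ∫⁻ ω, (∫⁻ y, f (A.extend θ' t ((ω.1, A.history θ ω t), y)) ∂(gaussianReal 0 v))
            ∂(seedNoise ρ v) + ε / 2 := by
          rw [lintegral_add_right _ measurable_const]; simp
      _ ≤ _ + ε / 2 + ε / 2 := by
          gcongr
          refine ih _ hG fun p => ?_
          exact (lintegral_mono fun y => hf1 _).trans (by simp)
      _ = _ := by rw [add_assoc, ENNReal.add_halves]

theorem lowerSemicontinuous_measure_history_mem (A : Algorithm d Z U) (ρ : Measure U)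
    [IsProbabilityMeasure ρ] (v : ℝ≥0) (hv : v ≠ 0) (t : ℕ) {S : Set (U × History d t)}
    (hS : MeasurableSet S) :
    LowerSemicontinuous fun θ => seedNoise ρ v {ω | (ω.1, A.history θ ω t) ∈ S} := by
  have e : ∀ θ, ∫⁻ ω, S.indicator 1 (ω.1, A.history θ ω t) ∂(seedNoise ρ v) =
      seedNoise ρ v {ω | (ω.1, A.history θ ω t) ∈ S} := fun θ =>
    lintegral_indicator_one (A.measurable_history θ t hS)
  intro θ y hy
  obtain ⟨r, hr0, hr⟩ := ENNReal.lt_iff_exists_add_pos_lt.1 hy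
  filter_upwards [A.eventually_lintegral_history_le ρ v hv θ t
    (ε := r) (by simpa using hr0.ne')] with θ' h
  have h' := h (S.indicator 1) (measurable_one.indicator hS)
    (Set.indicator_le_self' (fun _ _ => zero_le))
  rw [e, e] at h'
  exact (ENNReal.add_lt_add_iff_right ENNReal.coe_ne_top).1 (hr.trans_le h')

/-! ### Stopping and recommendation -/

theorem coe_lt_stoppingTime_iff (A : Algorithm d Z U) (θ : Fin d → ℝ) (ω : U × (ℕ → ℝ)) (t : ℕ) :
    (t : ℕ∞) < A.stoppingTime θ ω ↔ ∀ s ≤ t, (ω.1, A.history θ ω s) ∉ A.halt s := by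
  rw [← ENat.add_one_le_iff (ENat.natCast_ne_top t), stoppingTime, le_iInf₂_iff]
  refine forall_congr' fun s => ?_
  norm_cast
  rw [Nat.succ_le_iff, ← not_le]
  tauto

theorem stoppingTime_eq_coe_iff (A : Algorithm d Z U) (θ : Fin d → ℝ) (ω : U × (ℕ → ℝ)) (t : ℕ) :
    A.stoppingTime θ ω = t ↔ (ω.1, A.history θ ω t) ∈ A.halt t ∧
      ∀ s < t, (ω.1, A.history θ ω s) ∉ A.halt s := by
  constructor
  · intro h
    have hlt : ∀ s < t, (ω.1, A.history θ ω s) ∉ A.halt s := fun s hs =>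
      (A.coe_lt_stoppingTime_iff θ ω s).1 (by rw [h]; exact_mod_cast hs) s le_rfl
    refine ⟨?_, hlt⟩
    by_contra hn
    refine lt_irrefl (t : ℕ∞) (h.subst ((A.coe_lt_stoppingTime_iff θ ω t).2 fun s hs => ?_))
    rcases hs.lt_or_eq with hs | rfl
    exacts [hlt s hs, hn]
  · rintro ⟨h, hlt⟩
    refine le_antisymm (iInf₂_le t h) (le_iInf₂ fun s hs => ?_)
    by_contra! hst
    exact hlt s (by exact_mod_cast hst) hs

/-- Earlier histories are prefixes of later ones, so stopping at exactly `t` can be read off the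
history at `t`. -/
theorem history_castLE (A : Algorithm d Z U) (θ : Fin d → ℝ) (ω : U × (ℕ → ℝ)) {s t : ℕ}
    (h : s ≤ t) : (fun j => A.history θ ω t (Fin.castLE h j)) = A.history θ ω s := by
  induction t, h using Nat.le_induction with
  | base => rfl
  | succ t h ih =>
    rw [← ih]
    funext j
    exact Fin.snoc_castSucc (α := fun _ => Fin d × ℝ) _ _ (Fin.castLE h j)

/-- The seeds and histories on which the algorithm stops after exactly `t` rounds and
recommends `z`. -/
def stopSet (A : Algorithm d Z U) (z : Finset (Fin d)) (t : ℕ) : Set (U × History d t) :=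
  {p | (p ∈ A.halt t ∧ ∀ s : Fin t, (p.1, fun j => p.2 (Fin.castLE s.2.le j)) ∉ A.halt s) ∧
    A.recommend t p = z}

theorem measurableSet_stopSet (A : Algorithm d Z U) (z : Finset (Fin d)) (t : ℕ) :
    MeasurableSet (A.stopSet z t) := by
  refine ((A.measurableSet_halt t).inter ?_).inter (A.measurableSet_recommend t z)
  have : {p : U × History d t | ∀ s : Fin t,
      (p.1, fun j => p.2 (Fin.castLE s.2.le j)) ∉ A.halt s} =
      ⋂ s : Fin t, (fun p : U × History d t =>
        (p.1, fun j => p.2 (Fin.castLE s.2.le j))) ⁻¹' (A.halt s)ᶜ := by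
    ext p; simp
  change MeasurableSet {p : U × History d t | ∀ s : Fin t,
      (p.1, fun j => p.2 (Fin.castLE s.2.le j)) ∉ A.halt s}
  rw [this]
  refine MeasurableSet.iInter fun s => ?_
  refine (measurable_fst.prodMk (measurable_pi_iff.2 fun j => ?_)) (A.measurableSet_halt s).compl
  exact (measurable_pi_apply _).comp measurable_snd

theorem history_mem_stopSet_iff (A : Algorithm d Z U) (θ : Fin d → ℝ) (z : Finset (Fin d))
    (ω : U × (ℕ → ℝ)) (t : ℕ) : (ω.1, A.history θ ω t) ∈ A.stopSet z t ↔
      A.stoppingTime θ ω = t ∧ A.recommend t (ω.1, A.history θ ω t) = z := by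
  rw [stoppingTime_eq_coe_iff]
  simp only [stopSet, Set.mem_ofPred_eq, history_castLE, Fin.forall_iff]

theorem recommends_eq_iUnion (A : Algorithm d Z U) (θ : Fin d → ℝ) (z : Finset (Fin d)) :
    A.recommends θ z = ⋃ t, {ω | (ω.1, A.history θ ω t) ∈ A.stopSet z t} := by
  ext ω
  simp only [recommends, Set.mem_iUnion, Set.mem_ofPred_eq, history_mem_stopSet_iff]

theorem measurableSet_recommends (A : Algorithm d Z U) (θ : Fin d → ℝ) (z : Finset (Fin d)) :
    MeasurableSet (A.recommends θ z) := by
  rw [recommends_eq_iUnion]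
  exact .iUnion fun t => A.measurable_history θ t (A.measurableSet_stopSet z t)

/-- The event splits by the value of the stopping time into events of finite histories, and a sum of
nonnegative lower semicontinuous functions is lower semicontinuous. -/
theorem lowerSemicontinuous_measure_recommends (A : Algorithm d Z U) (ρ : Measure U)
    [IsProbabilityMeasure ρ] (v : ℝ≥0) (hv : v ≠ 0) (z : Finset (Fin d)) :
    LowerSemicontinuous fun θ => seedNoise ρ v (A.recommends θ z) := by
  have e : ∀ θ, seedNoise ρ v (A.recommends θ z) =
      ∑' t, seedNoise ρ v {ω | (ω.1, A.history θ ω t) ∈ A.stopSet z t} := by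
    intro θ
    rw [recommends_eq_iUnion]
    refine measure_iUnion ?_ fun t => A.measurable_history θ t (A.measurableSet_stopSet z t)
    intro t t' htt
    refine Set.disjoint_left.2 fun ω h h' => htt ?_
    have h1 := ((A.history_mem_stopSet_iff θ z ω t).1 h).1
    have h2 := ((A.history_mem_stopSet_iff θ z ω t').1 h').1
    exact_mod_cast h1.symm.trans h2
  simp only [e]
  exact lowerSemicontinuous_tsum fun t =>
    A.lowerSemicontinuous_measure_history_mem ρ v hv t (A.measurableSet_stopSet z t)

theorem disjoint_recommends (A : Algorithm d Z U) (θ : Fin d → ℝ) {z z' : Finset (Fin d)}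
    (h : z ≠ z') : Disjoint (A.recommends θ z) (A.recommends θ z') := by
  refine Set.disjoint_left.2 ?_
  rintro ω ⟨t, ht, rfl⟩ ⟨t', ht', rfl⟩
  obtain rfl : t = t' := by exact_mod_cast ht.symm.trans ht'
  exact h rfl

/-! ### Comparison of two instances -/

/-- Without a pull of `e_i`, a change of `θ_i` does not affect the run. -/
theorem mem_recommends_of_pulls_eq_zero (A : Algorithm d Z U) {θ θ' : Fin d → ℝ} {i : Fin d}
    (hθ : ∀ j ≠ i, θ' j = θ j) {z : Finset (Fin d)} {ω : U × (ℕ → ℝ)}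
    (h : ω ∈ A.recommends θ z) (hi : A.pulls θ i ω = 0) : ω ∈ A.recommends θ' z := by
  obtain ⟨t, ht, hz⟩ := h
  have hh : ∀ s ≤ t, A.history θ' ω s = A.history θ ω s := by
    intro s hs
    induction s with
    | zero => rfl
    | succ s ih =>
      have hne : A.sample s (ω.1, A.history θ ω s) ≠ i := fun he =>
        Set.eq_empty_iff_forall_notMem.1 (Set.encard_eq_zero.1 hi) s
          ⟨by rw [ht]; exact_mod_cast hs, he⟩
      simp only [history, ih (Nat.le_of_succ_le hs), hθ _ hne]
  refine ⟨t, ?_, by rw [hh t le_rfl, hz]⟩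
  rw [stoppingTime_eq_coe_iff] at ht ⊢
  refine ⟨by rw [hh t le_rfl]; exact ht.1, fun s hs => ?_⟩
  rw [hh s hs.le]
  exact ht.2 s hs

theorem measurableSet_pulls_ne_zero (A : Algorithm d Z U) (θ : Fin d → ℝ) (i : Fin d) :
    MeasurableSet {ω | A.pulls θ i ω ≠ 0} := by
  have e : {ω | A.pulls θ i ω ≠ 0} = ⋃ t : ℕ, (⋂ (s : ℕ) (_ : s ≤ t),
      {ω | (ω.1, A.history θ ω s) ∉ A.halt s}) ∩ {ω | A.arm θ ω t = i} := by
    ext ω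
    simp [pulls, coe_lt_stoppingTime_iff, ← Set.nonempty_iff_ne_empty, Set.Nonempty]
  rw [e]
  refine .iUnion fun t => .inter (.iInter fun s => .iInter fun _ => ?_) ?_
  · exact A.measurable_history θ s (A.measurableSet_halt s).compl
  · exact (A.measurable_sample t).comp (A.measurable_history θ t) (measurableSet_singleton i)

/-- On a limit of instances of `Θ` in which `zs` is not optimal, a `δ`-PAC algorithm recommends
`zs` with probability at most `δ`. -/
theorem measure_recommends_le (A : Algorithm d Z U) {ρ : Measure U} [IsProbabilityMeasure ρ]
    {v : ℝ≥0} (hv : v ≠ 0) {Θ : Set (Fin d → ℝ)} {δ : ℝ} (hδ : 0 ≤ δ) (hδ' : δ ≤ 1)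
    (hA : A.IsPAC ρ v Θ δ) {θ : Fin d → ℝ} (hθ : θ ∈ closure (uniqueInstances Z Θ))
    {zs : Finset (Fin d)} (hzs : ∃ z ∈ Z, value θ zs < value θ z) :
    seedNoise ρ v (A.recommends θ zs) ≤ ENNReal.ofReal δ := by
  obtain ⟨z, hz, hlt⟩ := hzs
  by_contra! hgt
  have hopen : ∀ᶠ θ' in 𝓝 θ, value θ' zs < value θ' z :=
    (continuous_value zs).tendsto θ |>.eventually_lt ((continuous_value z).tendsto θ) hlt
  -- Both strict inequalities persist near `θ`, hence hold at a genuine instance `θ'`; there the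
  -- probabilities of `z'` and `zs` would sum to more than `1`.
  obtain ⟨θ', ⟨hΘ, z', hz'⟩, hlt', hgt'⟩ := ((mem_closure_iff_frequently.1 hθ).and_eventually
    (hopen.and (A.lowerSemicontinuous_measure_recommends ρ v hv zs θ _ hgt))).exists
  have hne : z' ≠ zs := by
    rintro rfl
    exact lt_asymm hlt' (hz'.2 z hz (by rintro rfl; exact lt_irrefl _ hlt'))
  have hsum := measure_union (μ := seedNoise ρ v) (A.disjoint_recommends θ' hne)
    (A.measurableSet_recommends θ' zs)
  have h1 : ENNReal.ofReal (1 - δ) + ENNReal.ofReal δ <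
      seedNoise ρ v (A.recommends θ' z') + seedNoise ρ v (A.recommends θ' zs) :=
    ENNReal.add_lt_add_of_le_of_lt ENNReal.ofReal_ne_top (hA θ' hΘ z' hz') hgt'
  rw [← hsum, ← ENNReal.ofReal_add (by linarith) hδ, sub_add_cancel, ENNReal.ofReal_one] at h1
  exact absurd prob_le_one (not_le.2 h1)

theorem le_measure_pulls_ne_zero (A : Algorithm d Z U) {ρ : Measure U} [IsProbabilityMeasure ρ]
    {v : ℝ≥0} (hv : v ≠ 0) {Θ : Set (Fin d → ℝ)} {δ : ℝ} (hδ : 0 ≤ δ) (hδ' : δ ≤ 1)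
    (hA : A.IsPAC ρ v Θ δ) {θ θ' : Fin d → ℝ} (hθ : θ ∈ Θ) {zs : Finset (Fin d)}
    (hzs : IsUniqueBest Z θ zs) {i : Fin d} (hθ' : θ' ∈ closure (uniqueInstances Z Θ))
    (hoff : ∀ j ≠ i, θ' j = θ j) (hlt : ∃ z ∈ Z, value θ' zs < value θ' z) :
    ENNReal.ofReal (1 - 2 * δ) ≤ seedNoise ρ v {ω | A.pulls θ i ω ≠ 0} := by
  have h1 : ENNReal.ofReal (1 - δ) ≤
      ENNReal.ofReal δ + seedNoise ρ v {ω | A.pulls θ i ω ≠ 0} := by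
    refine (hA θ hθ zs hzs).trans ?_
    refine (measure_mono fun ω hω => ?_).trans ((measure_union_le (A.recommends θ' zs) _).trans
      (add_le_add_left (A.measure_recommends_le hv hδ hδ' hA hθ' hlt) _))
    by_cases h : A.pulls θ i ω = 0
    · exact Or.inl (A.mem_recommends_of_pulls_eq_zero hoff hω h)
    · exact Or.inr h
  rw [show 1 - 2 * δ = 1 - δ - δ by ring, ENNReal.ofReal_sub _ hδ]
  exact tsub_le_iff_left.2 h1

end Algorithm

end CombBandit

/-! ### Summation over the arms -/

open CombBandit

theorem mainTheorem10 {d : ℕ} (Z : Finset (Finset (Fin d)))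
    (hZ : ∀ i : Fin d, (∃ z ∈ Z, i ∈ z) ∧ (∃ z ∈ Z, i ∉ z))
    (v : ℝ≥0) (hv : v ≠ 0) (δ : ℝ) (hδ : 0 < δ) (hδ' : δ < 1 / 4)
    (Θ : Set (Fin d → ℝ)) (θ : Fin d → ℝ) (hθ : θ ∈ Θ)
    (zs : Finset (Fin d)) (hzs : CombBandit.IsUniqueBest Z θ zs)
    (hΘ : ∀ i : Fin d,
      (i ∈ zs ∧ ∃ s : ℝ, CombBandit.minGapWithout Z θ zs i < s ∧
        θ - Pi.single i s ∈ closure (CombBandit.uniqueInstances Z Θ)) ∨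
      (i ∉ zs ∧ ∃ s : ℝ, CombBandit.minGapWith Z θ zs i < s ∧
        θ + Pi.single i s ∈ closure (CombBandit.uniqueInstances Z Θ)))
    {U : Type*} [MeasurableSpace U] (ρ : Measure U) [IsProbabilityMeasure ρ]
    (A : CombBandit.Algorithm d Z U) (hA : A.IsPAC ρ v Θ δ) :
    (d : ℝ≥0∞) / 2 ≤
      ∫⁻ ω, ∑ i : Fin d, ((A.pulls θ i ω : ℕ∞) : ℝ≥0∞) ∂(CombBandit.seedNoise ρ v) := by
  have key : ∀ i, (2⁻¹ : ℝ≥0∞) ≤ seedNoise ρ v {ω | A.pulls θ i ω ≠ 0} := by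
    intro i
    obtain ⟨θ', hθ', hoff, hlt⟩ : ∃ θ' ∈ closure (uniqueInstances Z Θ),
        (∀ j ≠ i, θ' j = θ j) ∧ ∃ z ∈ Z, value θ' zs < value θ' z := by
      rcases hΘ i with ⟨hi, s, hs, hcl⟩ | ⟨hi, s, hs, hcl⟩
      · exact ⟨_, hcl, fun j hj => by simp [hj], exists_value_lt_sub_single (hZ i).2 hi hs⟩
      · exact ⟨_, hcl, fun j hj => by simp [hj], exists_value_lt_add_single (hZ i).1 hi hs⟩
    refine le_trans ?_ (A.le_measure_pulls_ne_zero hv hδ.le (by linarith) hA hθ hzs hθ' hoff hlt)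
    rw [← ENNReal.ofReal_ofNat, ← ENNReal.ofReal_inv_of_pos two_pos]
    -- This is where `δ < 1/4` gives `1/2 ≤ 1 - 2δ`.
    exact ENNReal.ofReal_le_ofReal (by linarith)
  calc (d : ℝ≥0∞) / 2 = ∑ _i : Fin d, (2⁻¹ : ℝ≥0∞) := by simp [div_eq_mul_inv]
    _ ≤ ∑ i, seedNoise ρ v {ω | A.pulls θ i ω ≠ 0} := Finset.sum_le_sum fun i _ => key i
    _ = ∫⁻ ω, ∑ i, {ω | A.pulls θ i ω ≠ 0}.indicator 1 ω ∂(seedNoise ρ v) := by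
        rw [lintegral_finsetSum _ fun i _ =>
          measurable_one.indicator (A.measurableSet_pulls_ne_zero θ i)]
        exact Finset.sum_congr rfl fun i _ =>
          (lintegral_indicator_one (A.measurableSet_pulls_ne_zero θ i)).symm
    _ ≤ _ := by
        refine lintegral_mono fun ω => Finset.sum_le_sum fun i _ => ?_
        rw [Set.indicator_apply]
        split_ifs with hω
        · have : (1 : ℕ∞) ≤ A.pulls θ i ω := Order.one_le_iff_ne_zero.2 hω
          rw [Pi.one_apply]
          simpa using ENat.toENNReal_le.2 this
        · exact zero_le
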